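/- For a finite simple graph $\Gamma$ with vertex set $V$ let $G(\Gamma)=\langle s\in V \mid s^2=1\ (s\in V),\ (ss')^2=1\ (\{s,s'\}\in E(\Gamma))\rangle$ be the right-angled Coxeter group (RACG) based on $\Gamma$. A word $w\in V^*$ is geodesic if its length $|w|$ equals the word length, with respect to $V$, of the element of $G(\Gamma)$ that it represents. Let $f_{Geo(\Gamma)}(r)$ be the number of geodesic words of length $r$, and for a vertex $0$ let $f_{Geo_0(\Gamma)}(r)$ and $f_{Geo^0(\Gamma)}(r)$ be the numbers of those that start, respectively end, with the letter $0$. The geodesic growth series of $G(\Gamma)$ is $\sum_{r\ge 0} f_{Geo(\Gamma)}(r)\,t^r$. The coalescence $\tau\cdot\sigma$ of two rooted trees is the tree obtained from their disjoint union by identifying the two roots. Let $S_1$ and $S_2$ be the trees on $\{0,\dots,9\}$, rooted at $0$, with edge sets $$E(S_1)=\{01,02,13,24,25,36,57,78,79\},\qquad E(S_2)=\{01,02,13,14,25,26,37,78,89\},$$ and let $S_1'$ and $S_2'$ be the trees on $\{0,\dots,10\}$, rooted at $0$, obtained from $S_1$ by subdividing the edge $57$, and from $S_2$ by subdividing the edge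 $01$, with a new vertex $10$. (a) For every finite rooted tree $\tau$ with at least two vertices, the RACGs $G(\tau\cdot S_1)$ and $G(\tau\cdot S_2)$ have distinct geodesic growth series; more precisely, $f_{Geo(\tau\cdot S_1)}(10)\ne f_{Geo(\tau\cdot S_2)}(10)$. (b) For every finite rooted tree $\tau$ with at least two vertices, the RACGs $G(\tau\cdot S_1')$ and $G(\tau\cdot S_2')$ have distinct geodesic growth series; more precisely, $f_{Geo(\tau\cdot S_1')}(10)\ne f_{Geo(\tau\cdot S_2')}(10)$. (c) $f_{Geo_0(S_1')}(r)=f_{Geo_0(S_2')}(r)$ for all $r<8$, while $f_{Geo_0(S_1')}(8)=f_{Geo^0(S_1')}(8)=8919523$ and $f_{Geo_0(S_2')}(8)=f_{Geo^0(S_2')}(8)=8919522$. -/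

import Mathlib

noncomputable section

namespace RACG

universe u v

open Classical in
/-- The Coxeter matrix of the right-angled Coxeter group based on a simple graph: `1` on the
diagonal, `2` for adjacent vertices, and `0` (Mathlib's encoding of `∞`, that is, no relation) for
distinct non-adjacent vertices. -/
def coxeterMatrix {V : Type u} (Γ : SimpleGraph V) : CoxeterMatrix V where
  M := Matrix.of fun s s' => if s = s' then 1 else if Γ.Adj s s' then 2 else 0
  isSymm := by
    ext s s'
    simp only [Matrix.transpose_apply, Matrix.of_apply, eq_comm (a := s') (b := s),
      Γ.adj_comm s' s]
  diagonal := by simp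
  off_diagonal := by
    intro s s' h
    simp only [Matrix.of_apply, h, if_false]
    split_ifs <;> decide

/-- The right-angled Coxeter group based on `Γ`, as the group with generators the vertices `s`
and relations `s ^ 2 = 1` for all `s`, `(s s') ^ 2 = 1` for all edges `{s, s'}`. -/
abbrev Grp {V : Type u} (Γ : SimpleGraph V) : Type u := (coxeterMatrix Γ).Group

/-- The right-angled Coxeter group with its standard generating set, the vertices of `Γ`. -/
abbrev system {V : Type u} (Γ : SimpleGraph V) : CoxeterSystem (coxeterMatrix Γ) (Grp Γ) :=
  (coxeterMatrix Γ).toCoxeterSystem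

/-- `Geo(Γ)`: the words over the vertices of `Γ` that are geodesic in the right-angled Coxeter
group, i.e. whose length is the word length of the element they represent. -/
def Geo {V : Type u} (Γ : SimpleGraph V) : Set (List V) :=
  {w | (system Γ).length ((system Γ).wordProd w) = w.length}

/-- The geodesic words that start with the letter `x`. -/
def GeoStart {V : Type u} (Γ : SimpleGraph V) (x : V) : Set (List V) :=
  {w | w ∈ Geo Γ ∧ w.head? = some x}

/-- The geodesic words that end with the letter `x`. -/
def GeoEnd {V : Type u} (Γ : SimpleGraph V) (x : V) : Set (List V) :=
  {w | w ∈ Geo Γ ∧ w.getLast? = some x}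

/-- The strict growth function of a language. Over a finite alphabet the sets counted here are
finite. -/
def growth {V : Type u} (L : Set (List V)) (r : ℕ) : ℕ :=
  {w | w ∈ L ∧ w.length = r}.ncard

/-- The geodesic growth series of the right-angled Coxeter group based on `Γ`. -/
def geodesicGrowthSeries {V : Type u} (Γ : SimpleGraph V) : PowerSeries ℕ :=
  PowerSeries.mk (growth (Geo Γ))

/-- The coalescence of the rooted graphs `(τ, a)` and `(σ, b)`: their disjoint union with the
roots merged. The merged root is `Sum.inl a`. -/
def coalescence {V : Type u} {W : Type v} (τ : SimpleGraph V) (a : V) (σ : SimpleGraph W) (b : W) :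
    SimpleGraph (V ⊕ {w : W // w ≠ b}) where
  Adj
    | .inl x, .inl y => τ.Adj x y
    | .inl x, .inr w => x = a ∧ σ.Adj b w
    | .inr w, .inl x => x = a ∧ σ.Adj b w
    | .inr w, .inr w' => σ.Adj w w'
  symm := ⟨by
    rintro (x | w) (y | w') h
    · exact h.symm
    · exact h
    · exact h
    · exact h.symm⟩
  loopless := ⟨by
    rintro (x | w) h
    · exact h.ne rfl
    · exact h.ne rfl⟩

/-- The graph on `Fin n` with the listed edges. -/
def ofEdges (n : ℕ) (l : List (Fin n × Fin n)) : SimpleGraph (Fin n) :=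
  SimpleGraph.fromRel fun i j => (i, j) ∈ l

/-- The ten-vertex tree `S₁`, rooted at `0`. -/
def S₁ : SimpleGraph (Fin 10) :=
  ofEdges 10 [(0, 1), (0, 2), (1, 3), (2, 4), (2, 5), (3, 6), (5, 7), (7, 8), (7, 9)]

/-- The ten-vertex tree `S₂`, rooted at `0`. -/
def S₂ : SimpleGraph (Fin 10) :=
  ofEdges 10 [(0, 1), (0, 2), (1, 3), (1, 4), (2, 5), (2, 6), (3, 7), (7, 8), (8, 9)]

/-- The eleven-vertex version of `S₁`, rooted at `0`: the edge `{5, 7}` is subdivided by a new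
vertex `10`. -/
def S₁ext : SimpleGraph (Fin 11) :=
  ofEdges 11 [(0, 1), (0, 2), (1, 3), (2, 4), (2, 5), (3, 6), (5, 10), (10, 7), (7, 8), (7, 9)]

/-- The eleven-vertex version of `S₂`, rooted at `0`: the edge `{0, 1}` is subdivided by a new
vertex `10`. -/
def S₂ext : SimpleGraph (Fin 11) :=
  ofEdges 11 [(0, 10), (10, 1), (0, 2), (1, 3), (1, 4), (2, 5), (2, 6), (3, 7), (7, 8), (8, 9)]

end RACG

end

/-! A word in a right-angled Coxeter group is geodesic exactly when no letter can be commuted back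
to an equal earlier letter and cancelled. This is tested by an automaton whose state is the set of
letters that can be moved to the end (`mem_Geo_iff`). That acceptance implies geodesicity comes from
an integral linear action of the group: signs of coordinates recover the state from the group
element alone (`coord_sign_invariant`).

In a coalescence, non-root letters of different factors never commute, so the factors interact only
through the root. Cut a word after its longest prefix over σ. The number of continuations into τ
depends only on whether the root is in the state at the cut. With Y the counts of continuations from
∅ and from {root}, each prefix length contributes free · Y(∅) + hang · Y({root}) = (free + hang) ·
Y({root}) + free · (Y(∅) - Y({root})). Larger states allow fewer continuations, so this is monotone
in free, in free + hang and in Y. Hence finitely many inequalities between σ₁ and σ₂ (`Dominated`)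
pass by induction on length to coalescences with every τ.

Strictness needs one strict inequality between the free counts and a neighbour of the root in τ,
which makes Y(∅) > Y({root}) at length 2. A strict inequality at prefix length 8 thus separates the
growth at length 10. The inequalities and the counts of geodesics starting at the root are read off
tables computed by dynamic programming; reversal of words handles those ending at the root. -/

noncomputable section

namespace RACG

universe u v

/-! ### The geodesic automaton -/

section Automaton

variable {V : Type u} (Γ : SimpleGraph V)

/-- The transition of the geodesic automaton: a state is the set of letters in which the words
leading to it can end after commutations. -/
def next (D : Set V) (s : V) : Set V := insert s (D ∩ Γ.neighborSet s)

/-- The words that can be read from the state `D`. -/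
def Readable : Set V → List V → Prop
  | _, [] => True
  | D, s :: w => s ∉ D ∧ Readable (next Γ D s) w

/-- The state reached from `D` by reading `w`. -/
def state (D : Set V) (w : List V) : Set V := w.foldl (next Γ) D

variable {Γ}

theorem mem_next {D : Set V} {s t : V} : t ∈ next Γ D s ↔ t = s ∨ t ∈ D ∧ Γ.Adj s t := Iff.rfl

@[simp] theorem state_nil (D : Set V) : state Γ D [] = D := rfl

theorem state_concat (D : Set V) (w : List V) (s : V) :
    state Γ D (w ++ [s]) = next Γ (state Γ D w) s := by
  simp [state]

theorem readable_concat {D : Set V} {w : List V} {s : V} :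
    Readable Γ D (w ++ [s]) ↔ Readable Γ D w ∧ s ∉ state Γ D w := by
  induction w generalizing D with
  | nil => simp [Readable]
  | cons t w ih => simp [Readable, ih, state, and_assoc]

/-! ### The contragredient geometric representation -/

open Classical in
/-- The action of a generator on the coordinates with respect to the simple roots. -/
def reflect (Γ : SimpleGraph V) (s : V) (c : V → ℤ) : V → ℤ := fun t =>
  if t = s then -c s else if Γ.Adj s t then c t else c t + 2 * c s

theorem reflect_self (s : V) (c : V → ℤ) : reflect Γ s c s = -c s := by simp [reflect]

theorem reflect_of_adj {s t : V} (h : Γ.Adj s t) (c : V → ℤ) : reflect Γ s c t = c t := by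
  simp [reflect, h.ne', h]

theorem reflect_of_not_adj {s t : V} (hne : t ≠ s) (h : ¬Γ.Adj s t) (c : V → ℤ) :
    reflect Γ s c t = c t + 2 * c s := by
  simp [reflect, hne, h]

theorem reflect_reflect (s : V) (c : V → ℤ) : reflect Γ s (reflect Γ s c) = c := by
  funext t
  by_cases hts : t = s
  · subst hts; simp [reflect_self]
  by_cases h : Γ.Adj s t
  · simp [reflect_of_adj h]
  · simp [reflect_of_not_adj hts h, reflect_self]

theorem reflect_comm {s t : V} (h : Γ.Adj s t) (c : V → ℤ) :
    reflect Γ s (reflect Γ t c) = reflect Γ t (reflect Γ s c) := by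
  funext x
  have hne := h.ne
  by_cases hs : x = s
  · subst hs
    simp [reflect_self, reflect_of_adj h.symm]
  by_cases ht : x = t
  · subst ht
    simp [reflect_self, reflect_of_adj h]
  by_cases hxs : Γ.Adj s x <;> by_cases hxt : Γ.Adj t x <;>
    simp [reflect, hs, ht, hxs, hxt, hne, hne.symm, h, h.symm]
  ring

theorem isLiftable_reflect (Γ : SimpleGraph V) :
    (coxeterMatrix Γ).IsLiftable (G := Function.End (V → ℤ)) (reflect Γ) := by
  classical
  intro s t
  have hM : (coxeterMatrix Γ) s t = if s = t then 1 else if Γ.Adj s t then 2 else 0 := by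
    change Matrix.of _ s t = _
    rw [Matrix.of_apply]
  rw [hM]
  split_ifs with h h'
  · subst h
    rw [pow_one]
    funext c
    exact reflect_reflect s c
  · rw [pow_two]
    funext c
    change reflect Γ s (reflect Γ t (reflect Γ s (reflect Γ t c))) = c
    rw [reflect_comm h', reflect_reflect, reflect_reflect]
  · rw [pow_zero]

/-- The action of the right-angled Coxeter group on coordinate functions. -/
def rep (Γ : SimpleGraph V) : Grp Γ →* Function.End (V → ℤ) :=
  (system Γ).lift ⟨_, isLiftable_reflect Γ⟩

theorem rep_simple (s : V) (c : V → ℤ) : rep Γ ((system Γ).simple s) c = reflect Γ s c :=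
  congrFun (CoxeterSystem.lift_apply_simple (G := Function.End (V → ℤ)) (system Γ)
    (isLiftable_reflect Γ) s) c

/-- The coordinates attached to a group element, obtained by acting on a point in the interior of
the fundamental chamber. -/
def coord (g : Grp Γ) : V → ℤ := rep Γ g⁻¹ fun _ => 1

/-- The inverse in `coord` turns right multiplication into the left action, so coordinates can be
updated letter by letter along a word. -/
theorem coord_mul_simple (g : Grp Γ) (s : V) :
    coord (g * (system Γ).simple s) = reflect Γ s (coord g) := by
  rw [coord, mul_inv_rev, CoxeterSystem.inv_simple, map_mul]
  exact rep_simple s _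

/-- The signs alone are not inductive. When a letter `u` is read, a letter `t` of the state not
adjacent to `u` leaves it, and its new coordinate `c t + 2 * c u` must be positive; the third clause
supplies this. That clause persists because reflecting in `u` turns the sum for the pair `s`, `u`
into `c s + c u`. -/
theorem coord_sign_invariant {w : List V} (hw : Readable Γ ∅ w) :
    (∀ t ∈ state Γ ∅ w, coord ((system Γ).wordProd w) t < 0) ∧
    (∀ t ∉ state Γ ∅ w, 0 < coord ((system Γ).wordProd w) t) ∧
    (∀ t ∈ state Γ ∅ w, ∀ s, s ≠ t → ¬Γ.Adj t s →
      0 < coord ((system Γ).wordProd w) s + coord ((system Γ).wordProd w) t) := by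
  induction w using List.reverseRecOn with
  | nil =>
    have h : coord (1 : Grp Γ) = fun _ => 1 := by
      rw [coord, inv_one, map_one]
      rfl
    simp [h]
  | append_singleton w u ih =>
    obtain ⟨hw, hu⟩ := readable_concat.1 hw
    obtain ⟨hneg, hpos, hsum⟩ := ih hw
    rw [CoxeterSystem.wordProd_append, CoxeterSystem.wordProd_singleton, coord_mul_simple,
      state_concat]
    generalize coord ((system Γ).wordProd w) = c at hneg hpos hsum
    generalize state Γ ∅ w = D at hneg hpos hsum hu
    have hcu := hpos u hu
    refine ⟨?_, ?_, ?_⟩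
    · rintro t (rfl | ⟨htD, hut⟩)
      · rw [reflect_self]; omega
      · rw [reflect_of_adj hut]; exact hneg t htD
    · intro t ht
      simp only [mem_next, not_or, not_and] at ht
      by_cases hut : Γ.Adj u t
      · rw [reflect_of_adj hut]
        exact hpos t fun h => ht.2 h hut
      · rw [reflect_of_not_adj ht.1 hut]
        by_cases htD : t ∈ D
        · have := hsum t htD u (Ne.symm ht.1) fun h => hut h.symm
          omega
        · have := hpos t htD
          omega
    · rintro t (rfl | ⟨htD, hut⟩) s hst hadj
      · rw [reflect_of_not_adj hst hadj, reflect_self]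
        by_cases hsD : s ∈ D
        · have := hsum s hsD t hst.symm fun h => hadj h.symm
          omega
        · have := hpos s hsD
          omega
      · have h1 := hsum t htD s hst hadj
        rw [reflect_of_adj hut]
        have hsu : s ≠ u := by
          rintro rfl
          exact hadj hut.symm
        by_cases hus : Γ.Adj u s
        · rwa [reflect_of_adj hus]
        · rw [reflect_of_not_adj hsu hus]
          omega

/-! ### Readable words and geodesic words -/

theorem simple_comm {s t : V} (h : Γ.Adj s t) :
    (system Γ).simple s * (system Γ).simple t = (system Γ).simple t * (system Γ).simple s := by
  classical
  have hM : (coxeterMatrix Γ) s t = 2 := by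
    simp [coxeterMatrix, h.ne, h]
  have hp := (system Γ).simple_mul_simple_pow s t
  rw [hM, pow_two] at hp
  have := eq_inv_of_mul_eq_one_left hp
  rwa [mul_inv_rev, CoxeterSystem.inv_simple, CoxeterSystem.inv_simple] at this

/-- The last occurrence of `s` commutes with every letter after it, since `s` survives in the state
only while adjacent letters are read. -/
theorem exists_wordProd_eq_mul_simple {w : List V} {s : V} (hs : s ∈ state Γ ∅ w) :
    ∃ w' : List V, w'.length + 1 = w.length ∧
      (system Γ).wordProd w = (system Γ).wordProd w' * (system Γ).simple s := by
  induction w using List.reverseRecOn with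
  | nil => simp at hs
  | append_singleton w u ih =>
    rw [state_concat] at hs
    rcases hs with rfl | ⟨hs, hus⟩
    · exact ⟨w, by simp, by simp [CoxeterSystem.wordProd_append]⟩
    · obtain ⟨w', hl, hw'⟩ := ih hs
      refine ⟨w' ++ [u], by simp [hl], ?_⟩
      simp only [CoxeterSystem.wordProd_append, CoxeterSystem.wordProd_singleton, hw', mul_assoc]
      rw [simple_comm hus]

theorem length_mul_simple_lt_of_mem_state {w : List V} {s : V} (hs : s ∈ state Γ ∅ w) :
    (system Γ).length ((system Γ).wordProd w * (system Γ).simple s) < w.length := by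
  obtain ⟨w', hl, hw'⟩ := exists_wordProd_eq_mul_simple hs
  rw [hw', CoxeterSystem.simple_mul_simple_cancel_right]
  have := (system Γ).length_wordProd_le w'
  omega

theorem readable_of_mem_Geo {w : List V} (hw : w ∈ Geo Γ) : Readable Γ ∅ w := by
  induction w using List.reverseRecOn with
  | nil => trivial
  | append_singleton w s ih =>
    have hw' : w ∈ Geo Γ := by
      have := CoxeterSystem.IsReduced.take (cs := system Γ) hw w.length
      rwa [List.take_left] at this
    refine readable_concat.2 ⟨ih hw', fun hs => ?_⟩
    have h1 := length_mul_simple_lt_of_mem_state hs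
    have h2 : (system Γ).length ((system Γ).wordProd (w ++ [s])) = (w ++ [s]).length := hw
    rw [CoxeterSystem.wordProd_append, CoxeterSystem.wordProd_singleton] at h2
    rw [List.length_append, List.length_singleton] at h2
    omega

/-- A reduced word for the same element is readable and has the same coordinates, so the last letter
`s` of the given word lies in its state too. Hence `s` is a right descent of the element, and
appending `s` increased the length. -/
theorem mem_Geo_of_readable {w : List V} (hw : Readable Γ ∅ w) : w ∈ Geo Γ := by
  induction w using List.reverseRecOn with
  | nil => simp [Geo]
  | append_singleton w s ih =>
    have hneg : coord ((system Γ).wordProd (w ++ [s])) s < 0 :=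
      (coord_sign_invariant hw).1 s (by rw [state_concat]; exact Or.inl rfl)
    have hwG : (system Γ).length ((system Γ).wordProd w) = w.length := ih (readable_concat.1 hw).1
    obtain ⟨w', hred, hw'⟩ := (system Γ).exists_isReduced ((system Γ).wordProd (w ++ [s]))
    have hs : s ∈ state Γ ∅ w' := by
      by_contra hs
      have := (coord_sign_invariant (readable_of_mem_Geo hred)).2.1 s hs
      rw [← hw'] at this
      omega
    have hlt := length_mul_simple_lt_of_mem_state hs
    rw [← hw', CoxeterSystem.wordProd_append, CoxeterSystem.wordProd_singleton,
      CoxeterSystem.simple_mul_simple_cancel_right, hwG, ← hred.eq, ← hw',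
      CoxeterSystem.wordProd_append, CoxeterSystem.wordProd_singleton] at hlt
    change (system Γ).length ((system Γ).wordProd (w ++ [s])) = (w ++ [s]).length
    rw [CoxeterSystem.wordProd_append, CoxeterSystem.wordProd_singleton, List.length_append,
      List.length_singleton]
    have := (system Γ).length_mul_simple ((system Γ).wordProd w) s
    omega

/-- The automaton accepts exactly the geodesic words. -/
theorem mem_Geo_iff {w : List V} : w ∈ Geo Γ ↔ Readable Γ ∅ w :=
  ⟨readable_of_mem_Geo, mem_Geo_of_readable⟩

end Automaton

/-! ### Counting words read by the automaton -/

section Counting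

variable {V : Type u}

section

variable {Γ : SimpleGraph V}

theorem next_empty (s : V) : next Γ ∅ s = {s} := by
  simp [next]

theorem growth_GeoStart_zero (x : V) : growth (GeoStart Γ x) 0 = 0 := by
  have : {w | w ∈ GeoStart Γ x ∧ w.length = 0} = ∅ := by
    ext w
    simp only [GeoStart, Set.mem_ofPred_eq, Set.mem_empty_iff_false, iff_false]
    rintro ⟨⟨-, h⟩, h0⟩
    rw [List.length_eq_zero_iff] at h0
    simp [h0] at h
  rw [growth, this, Set.ncard_empty]

/-- The reversed word represents the inverse element, which has the same length. -/
theorem growth_GeoEnd (x : V) (n : ℕ) : growth (GeoEnd Γ x) n = growth (GeoStart Γ x) n := by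
  have : {w | w ∈ GeoEnd Γ x ∧ w.length = n} =
      List.reverse '' {w | w ∈ GeoStart Γ x ∧ w.length = n} := by
    ext w
    rw [Set.image_eq_preimage_of_inverse List.reverse_reverse List.reverse_reverse]
    simp [GeoEnd, GeoStart, Geo]
  rw [growth, this, Set.ncard_image_of_injective _ List.reverse_injective, growth]

end

variable [Fintype V]

open Classical in
/-- The number of words of length `n` that can be read from `D`, each weighted by the value of `φ`
at the state it leads to. -/
def count (Γ : SimpleGraph V) (φ : Set V → ℕ) : ℕ → Set V → ℕ
  | 0, D => φ D
  | n + 1, D => ∑ s, if s ∈ D then 0 else count Γ φ n (next Γ D s)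

open Classical in
/-- The finset of words of length `n` that can be read from `D`. -/
def words (Γ : SimpleGraph V) : ℕ → Set V → Finset (List V)
  | 0, _ => {[]}
  | n + 1, D => Finset.univ.biUnion fun s =>
      if s ∈ D then ∅ else (words Γ n (next Γ D s)).image (List.cons s)

variable {Γ : SimpleGraph V}

theorem mem_words {n : ℕ} {D : Set V} {w : List V} :
    w ∈ words Γ n D ↔ Readable Γ D w ∧ w.length = n := by
  classical
  induction n generalizing D w with
  | zero =>
    simp only [words, Finset.mem_singleton, List.length_eq_zero_iff]
    exact ⟨fun h => ⟨h ▸ trivial, h⟩, And.right⟩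
  | succ n ih =>
    simp only [words, Finset.mem_biUnion, Finset.mem_univ, true_and]
    constructor
    · rintro ⟨s, hs⟩
      split_ifs at hs with h
      · simp at hs
      · obtain ⟨w', hw', rfl⟩ := Finset.mem_image.1 hs
        obtain ⟨h1, h2⟩ := ih.1 hw'
        exact ⟨⟨h, h1⟩, by simp [h2]⟩
    · rintro ⟨h1, h2⟩
      cases w with
      | nil => simp at h2
      | cons s w =>
        refine ⟨s, ?_⟩
        rw [if_neg h1.1]
        exact Finset.mem_image_of_mem _ (ih.2 ⟨h1.2, by simpa using h2⟩)

theorem card_words (n : ℕ) (D : Set V) : (words Γ n D).card = count Γ (fun _ => 1) n D := by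
  classical
  induction n generalizing D with
  | zero => simp [words, count]
  | succ n ih =>
    rw [words, count, Finset.card_biUnion]
    · refine Finset.sum_congr rfl fun s _ => ?_
      split_ifs
      · simp
      · rw [Finset.card_image_of_injective _ List.cons_injective, ih]
    · intro s _ t _ hst
      rw [Function.onFun, Finset.disjoint_left]
      intro w hs ht
      split_ifs at hs ht
      all_goals try simp at hs
      all_goals try simp at ht
      obtain ⟨_, _, rfl⟩ := hs
      obtain ⟨_, _, h⟩ := ht
      exact hst (List.cons.inj h).1.symm

theorem ncard_readable (n : ℕ) (D : Set V) :
    {w | Readable Γ D w ∧ w.length = n}.ncard = count Γ (fun _ => 1) n D := by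
  rw [← card_words, ← Set.ncard_coe_finset]
  congr 1
  ext w
  simp [mem_words]

theorem growth_Geo (n : ℕ) : growth (Geo Γ) n = count Γ (fun _ => 1) n ∅ := by
  simp only [growth, mem_Geo_iff, ncard_readable]

theorem growth_GeoStart_succ (x : V) (n : ℕ) :
    growth (GeoStart Γ x) (n + 1) = count Γ (fun _ => 1) n {x} := by
  have : {w | w ∈ GeoStart Γ x ∧ w.length = n + 1} =
      List.cons x '' {w | Readable Γ {x} w ∧ w.length = n} := by
    ext w
    simp only [GeoStart, mem_Geo_iff, Set.mem_ofPred_eq, Set.mem_image]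
    constructor
    · rintro ⟨⟨hr, hh⟩, hl⟩
      cases w with
      | nil => simp at hl
      | cons s w =>
        obtain rfl : s = x := by simpa using hh
        exact ⟨w, ⟨next_empty (Γ := Γ) s ▸ hr.2, by simpa using hl⟩, rfl⟩
    · rintro ⟨w, ⟨hr, hl⟩, rfl⟩
      exact ⟨⟨⟨Set.notMem_empty _, (next_empty (Γ := Γ) x).symm ▸ hr⟩, rfl⟩, by simp [hl]⟩
  rw [growth, this, Set.ncard_image_of_injective _ List.cons_injective, ncard_readable]

/-- A larger state forbids more letters, and transitions preserve inclusion of states. -/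
theorem count_anti (φ : Set V → ℕ) (hφ : Antitone φ) (n : ℕ) : Antitone (count Γ φ n) := by
  classical
  induction n with
  | zero => exact hφ
  | succ n ih =>
    intro D E hDE
    refine Finset.sum_le_sum fun s _ => ?_
    by_cases hE : s ∈ E
    · simp [hE]
    · rw [if_neg hE, if_neg fun h => hE (hDE h)]
      exact ih (Set.insert_subset_insert (Set.inter_subset_inter_left _ hDE))

end Counting

/-! ### Words over a coalescence -/

section Coalescence

variable {V : Type u} {W : Type v} {τ : SimpleGraph V} {a : V} {σ : SimpleGraph W} {b : W}

open Classical in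
/-- The inclusion of the second factor into a coalescence. -/
def emb (a : V) (b : W) (w : W) : V ⊕ {w : W // w ≠ b} :=
  if h : w = b then .inl a else .inr ⟨w, h⟩

theorem emb_root : emb a b b = .inl a := by simp [emb]

theorem emb_of_ne {w : W} (h : w ≠ b) : emb a b w = .inr ⟨w, h⟩ := by simp [emb, h]

theorem inl_mem_image_emb {x : V} {E : Set W} :
    .inl x ∈ emb a b '' E ↔ x = a ∧ b ∈ E := by
  constructor
  · rintro ⟨w, hw, h⟩
    by_cases hwb : w = b
    · subst hwb
      rw [emb_root] at h
      exact ⟨(Sum.inl.inj h).symm, hw⟩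
    · rw [emb_of_ne hwb] at h
      cases h
  · rintro ⟨rfl, h⟩
    exact ⟨b, h, emb_root⟩

theorem inr_mem_image_emb {w : {w : W // w ≠ b}} {E : Set W} :
    .inr w ∈ emb a b '' E ↔ (w : W) ∈ E := by
  constructor
  · rintro ⟨y, hy, h⟩
    by_cases hyb : y = b
    · subst hyb
      rw [emb_root] at h
      cases h
    · rw [emb_of_ne hyb] at h
      cases h
      exact hy
  · intro h
    exact ⟨w, h, emb_of_ne w.2⟩

theorem inl_mem_image_inl {x : V} {D : Set V} :
    (.inl x : V ⊕ {w : W // w ≠ b}) ∈ Sum.inl '' D ↔ x ∈ D := by simp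

theorem inr_not_mem_image_inl {w : {w : W // w ≠ b}} {D : Set V} :
    (.inr w : V ⊕ {w : W // w ≠ b}) ∉ Sum.inl '' D := by simp

/-! ### Transitions in a coalescence -/

theorem next_image_inl_inl (D : Set V) (x : V) :
    next (coalescence τ a σ b) (Sum.inl '' D) (.inl x) = Sum.inl '' next τ D x := by
  ext (y | w)
  · simp [mem_next, coalescence]
  · simp [mem_next, coalescence]

/-- A non-root letter of σ is adjacent to no letter of τ except possibly the root, so crossing over
keeps nothing of `D` beyond whether it contains the root. -/
theorem next_image_inl_inr (D : Set V) (w : {w : W // w ≠ b}) :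
    next (coalescence τ a σ b) (Sum.inl '' D) (.inr w) =
      emb a b '' next σ {y | y = b ∧ a ∈ D} w := by
  ext (y | z)
  · rw [inl_mem_image_emb]
    simp only [mem_next, coalescence, inl_mem_image_inl, Set.mem_ofPred_eq, reduceCtorEq, false_or,
      true_and, w.2.symm, σ.adj_comm b]
    constructor
    · rintro ⟨h, rfl, h'⟩
      exact ⟨rfl, h, h'⟩
    · rintro ⟨rfl, h, h'⟩
      exact ⟨h, rfl, h'⟩
  · rw [inr_mem_image_emb]
    simp only [mem_next, inr_not_mem_image_inl, Set.mem_ofPred_eq, Sum.inr.injEq, false_and,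
      or_false, z.2, Subtype.ext_iff]

theorem next_image_emb_emb (E : Set W) (w : W) :
    next (coalescence τ a σ b) (emb a b '' E) (emb a b w) = emb a b '' next σ E w := by
  by_cases hw : w = b
  · subst hw
    rw [emb_root]
    ext (y | z)
    · simp only [mem_next, inl_mem_image_emb, coalescence, Sum.inl.injEq, true_or, and_true,
        or_iff_left_iff_imp]
      exact fun h => h.1.1
    · simp only [mem_next, inr_mem_image_emb, coalescence, reduceCtorEq, true_and, z.2]
  · rw [emb_of_ne hw]
    ext (y | z)
    · simp only [mem_next, inl_mem_image_emb, coalescence, reduceCtorEq, false_or, σ.adj_comm b,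
        Ne.symm hw]
      tauto
    · simp only [mem_next, inr_mem_image_emb, coalescence, Sum.inr.injEq, Subtype.ext_iff]

theorem next_image_emb_inl (E : Set W) {x : V} (hx : x ≠ a) :
    next (coalescence τ a σ b) (emb a b '' E) (.inl x) =
      Sum.inl '' next τ {y | y = a ∧ b ∈ E} x := by
  ext (y | z)
  · simp only [mem_next, inl_mem_image_emb, inl_mem_image_inl, coalescence, Set.mem_ofPred_eq,
      Sum.inl.injEq]
  · simp only [mem_next, inr_mem_image_emb, inr_not_mem_image_inl, coalescence, reduceCtorEq, hx]
    simp

/-! ### Splitting words after their longest prefix over one factor -/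

variable [Fintype V] [Fintype W]

open Classical in
/-- The number of words over a coalescence that can be read from a state `D` of the first factor
and are empty or start with a letter of the first factor other than the root. -/
def countOuter (τ : SimpleGraph V) (a : V) (σ : SimpleGraph W) (b : W) : ℕ → Set V → ℕ
  | 0, _ => 1
  | n + 1, D => ∑ x, if x = a ∨ x ∈ D then 0 else
      count (coalescence τ a σ b) (fun _ => 1) n (Sum.inl '' next τ D x)

open Classical in
/-- The number of words of length `k` that can be read from `E` and lead to a state without the
letter `b`. -/
def countFree (σ : SimpleGraph W) (b : W) (k : ℕ) (E : Set W) : ℕ :=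
  count σ (fun F => if b ∈ F then 0 else 1) k E

open Classical in
/-- The number of words of length `k` that can be read from `E` and lead to a state with the
letter `b`. -/
def countHang (σ : SimpleGraph W) (b : W) (k : ℕ) (E : Set W) : ℕ :=
  count σ (fun F => if b ∈ F then 1 else 0) k E

theorem countFree_add_countHang (k : ℕ) (E : Set W) :
    countFree σ b k E + countHang σ b k E = count σ (fun _ => 1) k E := by
  classical
  induction k generalizing E with
  | zero => simp only [countFree, countHang, count]; split_ifs <;> rfl
  | succ k ih =>
    simp only [countFree, countHang, count] at ih ⊢
    rw [← Finset.sum_add_distrib]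
    refine Finset.sum_congr rfl fun s _ => ?_
    split_ifs
    · rfl
    · exact ih _

theorem countHang_one : countHang σ b 1 ∅ = 1 := by
  classical
  simp [countHang, count, next_empty]

/-- The contribution to the count of the words of length `n` over a coalescence of those whose
longest prefix over the second factor, read from `E`, has length `k`. -/
def splitTerm (τ : SimpleGraph V) (a : V) (σ : SimpleGraph W) (b : W) (E : Set W) (k n : ℕ) : ℕ :=
  countFree σ b k E * countOuter τ a σ b n ∅ + countHang σ b k E * countOuter τ a σ b n {a}

theorem splitTerm_zero (E : Set W) (n : ℕ) :
    splitTerm τ a σ b E 0 n = countOuter τ a σ b n {y | y = a ∧ b ∈ E} := by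
  by_cases h : b ∈ E <;> simp [splitTerm, countFree, countHang, count, h]

open Classical in
theorem splitTerm_succ (E : Set W) (k n : ℕ) :
    splitTerm τ a σ b E (k + 1) n =
      ∑ w, if w ∈ E then 0 else splitTerm τ a σ b (next σ E w) k n := by
  simp only [splitTerm, countFree, countHang, count]
  rw [Finset.sum_mul, Finset.sum_mul, ← Finset.sum_add_distrib]
  refine Finset.sum_congr rfl fun s _ => ?_
  split_ifs <;> simp

theorem sum_eq_add_sum_ne {M : Type*} [AddCommMonoid M] {ι : Type*} [Fintype ι] (i : ι)
    [Fintype {j // j ≠ i}] (f : ι → M) : ∑ j, f j = f i + ∑ j : {j // j ≠ i}, f j := by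
  classical
  rw [← Finset.add_sum_erase _ f (Finset.mem_univ i)]
  congr 1
  exact Finset.sum_subtype _ (by simp) _

open Classical in
theorem count_image_emb_succ (n : ℕ) (E : Set W) :
    count (coalescence τ a σ b) (fun _ => 1) (n + 1) (emb a b '' E) =
      countOuter τ a σ b (n + 1) {y | y = a ∧ b ∈ E} +
        ∑ w, if w ∈ E then 0 else
          count (coalescence τ a σ b) (fun _ => 1) n (emb a b '' next σ E w) := by
  rw [count, Fintype.sum_sum_type, sum_eq_add_sum_ne b,
    ← Finset.add_sum_erase _ _ (Finset.mem_univ a), countOuter,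
    ← Finset.add_sum_erase (a := a) _ _ (Finset.mem_univ a)]
  simp only [true_or, if_true, zero_add, inl_mem_image_emb, inr_mem_image_emb, true_and]
  rw [add_assoc, add_left_comm]
  congr 1
  · refine Finset.sum_congr rfl fun x hx => ?_
    have hxa := Finset.ne_of_mem_erase hx
    simp only [hxa, false_and, false_or, if_false, Set.mem_ofPred_eq, next_image_emb_inl E hxa]
  · congr 1
    · rw [← emb_root (a := a) (b := b), next_image_emb_emb]
    · refine Finset.sum_congr rfl fun w _ => ?_
      rw [← emb_of_ne (a := a) w.2, next_image_emb_emb]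

open Classical in
/-- Words read from a state of the second factor, split after their longest prefix over that
factor. -/
theorem count_image_emb (n : ℕ) (E : Set W) :
    count (coalescence τ a σ b) (fun _ => 1) n (emb a b '' E) =
      ∑ k ∈ Finset.range (n + 1), splitTerm τ a σ b E k (n - k) := by
  induction n generalizing E with
  | zero => simp [count, splitTerm_zero, countOuter]
  | succ n ih =>
    rw [count_image_emb_succ, Finset.sum_range_succ', add_comm, splitTerm_zero, Nat.sub_zero]
    congr 1
    simp only [splitTerm_succ, ih, Nat.add_sub_add_right]
    rw [Finset.sum_comm]
    refine Finset.sum_congr rfl fun w _ => ?_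
    split_ifs <;> simp

open Classical in
theorem count_image_inl_succ (n : ℕ) (D : Set V) :
    count (coalescence τ a σ b) (fun _ => 1) (n + 1) (Sum.inl '' D) =
      countOuter τ a σ b (n + 1) D +
        (if a ∈ D then 0 else
          count (coalescence τ a σ b) (fun _ => 1) n (Sum.inl '' next τ D a)) +
        ∑ w : {w : W // w ≠ b}, count (coalescence τ a σ b) (fun _ => 1) n
          (emb a b '' next σ {y | y = b ∧ a ∈ D} w) := by
  rw [count, Fintype.sum_sum_type, countOuter,
    ← Finset.add_sum_erase _ _ (Finset.mem_univ a),
    ← Finset.add_sum_erase (a := a) (f := fun x => if x = a ∨ x ∈ D then _ else _) _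
      (Finset.mem_univ a)]
  simp only [true_or, if_true, zero_add, inl_mem_image_inl, inr_not_mem_image_inl, if_false,
    next_image_inl_inr, next_image_inl_inl]
  congr 1
  rw [add_comm]
  congr 1
  refine Finset.sum_congr rfl fun x hx => ?_
  simp [Finset.ne_of_mem_erase hx]

open Classical in
/-- The words read from a state of the first factor that contains the root. -/
theorem count_image_inl_of_mem {D : Set V} (ha : a ∈ D) (n : ℕ) :
    count (coalescence τ a σ b) (fun _ => 1) n (Sum.inl '' D) =
      countOuter τ a σ b n D +
        ∑ k ∈ Finset.range n, splitTerm τ a σ b {b} (k + 1) (n - (k + 1)) := by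
  cases n with
  | zero => simp [count, countOuter]
  | succ n =>
    have hE : {y : W | y = b ∧ a ∈ D} = {b} := by ext; simp [ha]
    rw [count_image_inl_succ, if_pos ha, add_zero, hE]
    congr 1
    simp only [count_image_emb, splitTerm_succ, Nat.add_sub_add_right]
    rw [Finset.sum_comm]
    refine Finset.sum_congr rfl fun k _ => ?_
    rw [sum_eq_add_sum_ne b]
    simp only [Set.mem_singleton_iff, if_true, zero_add]
    refine Finset.sum_congr rfl fun w _ => ?_
    rw [if_neg w.2]

open Classical in
/-- The words read from a state of the first factor that does not contain the root. -/
theorem count_image_inl_of_not_mem {D : Set V} (ha : a ∉ D) (n : ℕ) :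
    count (coalescence τ a σ b) (fun _ => 1) (n + 1) (Sum.inl '' D) =
      countOuter τ a σ b (n + 1) D + countOuter τ a σ b n (next τ D a) +
        (∑ k ∈ Finset.range n, splitTerm τ a σ b ∅ (k + 2) (n - (k + 1)) +
          countFree σ b 1 ∅ * countOuter τ a σ b n ∅) := by
  have hE : {y : W | y = b ∧ a ∈ D} = ∅ := by ext; simp [ha]
  have hsplit : ∀ k m, splitTerm τ a σ b ∅ (k + 1) m = splitTerm τ a σ b {b} k m +
      ∑ w : {w : W // w ≠ b}, splitTerm τ a σ b (next σ ∅ w) k m := by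
    intro k m
    rw [splitTerm_succ, sum_eq_add_sum_ne b]
    simp [next_empty]
  -- Words over σ from `∅` are sorted by first letter, the root leading to `{b}`. In the `k = 0`
  -- terms the prefix consisting of the root alone gives `countOuter` from `{a}` on both sides. It
  -- cancels, and the remaining `{b}` terms are those of `count_image_inl_of_mem` for the state
  -- reached by reading the root. The result has no subtraction and can be compared term by term.
  have hB : ∑ k ∈ Finset.range (n + 1), splitTerm τ a σ b ∅ (k + 1) (n - k) =
      ∑ k ∈ Finset.range (n + 1), splitTerm τ a σ b {b} k (n - k) +
        ∑ w : {w : W // w ≠ b}, count (coalescence τ a σ b) (fun _ => 1) n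
          (emb a b '' next σ ∅ w) := by
    simp only [count_image_emb, hsplit, Finset.sum_add_distrib]
    rw [Finset.sum_comm (s := Finset.univ)]
  rw [Finset.sum_range_succ', Finset.sum_range_succ' (fun k => splitTerm τ a σ b {b} k (n - k)),
    splitTerm_zero] at hB
  have hH : {y : V | y = a ∧ b ∈ ({b} : Set W)} = {a} := by ext; simp
  have h1 : splitTerm τ a σ b ∅ 1 n =
      countFree σ b 1 ∅ * countOuter τ a σ b n ∅ + countOuter τ a σ b n {a} := by
    rw [splitTerm, countHang_one, one_mul]
  rw [hH, Nat.sub_zero, zero_add, h1] at hB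
  rw [count_image_inl_succ, if_neg ha, hE, count_image_inl_of_mem (show a ∈ next τ D a from Or.inl rfl)]
  simp only [add_assoc, Nat.reduceAdd] at hB ⊢
  omega

end Coalescence

/-! ### Comparison of two coalescences -/

section Comparison

/-- Summation by parts: only `p` and `p + q` need to grow, while `q` itself may decrease. -/
theorem mul_add_mul_le {p q p' q' x y x' y' : ℕ} (hp : p ≤ p') (hpq : p + q ≤ p' + q')
    (hx : x ≤ x') (hy : y ≤ y') (hyx : y' ≤ x') : p * x + q * y ≤ p' * x' + q' * y' := by
  obtain ⟨d, rfl⟩ := Nat.exists_eq_add_of_le hyx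
  calc p * x + q * y ≤ p * (y' + d) + q * y' := by gcongr
    _ = (p + q) * y' + p * d := by ring
    _ ≤ (p' + q') * y' + p' * d := by gcongr
    _ = p' * (y' + d) + q' * y' := by ring

theorem mul_add_mul_lt {p q p' q' x y x' y' : ℕ} (hp : p < p') (hpq : p + q ≤ p' + q')
    (hx : x ≤ x') (hy : y ≤ y') (hyx : y' < x') : p * x + q * y < p' * x' + q' * y' := by
  obtain ⟨d, rfl⟩ := Nat.exists_eq_add_of_le hyx.le
  have hd : 0 < d := by omega
  calc p * x + q * y ≤ p * (y' + d) + q * y' := by gcongr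
    _ = (p + q) * y' + p * d := by ring
    _ < (p' + q') * y' + p' * d :=
      Nat.add_lt_add_of_le_of_lt (Nat.mul_le_mul_right _ hpq) (Nat.mul_lt_mul_of_pos_right hp hd)
    _ = p' * (y' + d) + q' * y' := by ring

/-- `σ₁` has at most as many words of each length up to `K` as `σ₂`, both in total and among
those that can be continued by the root, from either of the states `∅` and `{root}`. -/
structure Dominated {W₁ W₂ : Type*} [Fintype W₁] [Fintype W₂] (σ₁ : SimpleGraph W₁) (b₁ : W₁)
    (σ₂ : SimpleGraph W₂) (b₂ : W₂) (K : ℕ) : Prop where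
  free_empty : ∀ k ≤ K, countFree σ₁ b₁ k ∅ ≤ countFree σ₂ b₂ k ∅
  all_empty : ∀ k ≤ K, count σ₁ (fun _ => 1) k ∅ ≤ count σ₂ (fun _ => 1) k ∅
  free_root : ∀ k ≤ K, countFree σ₁ b₁ k {b₁} ≤ countFree σ₂ b₂ k {b₂}
  all_root : ∀ k ≤ K, count σ₁ (fun _ => 1) k {b₁} ≤ count σ₂ (fun _ => 1) k {b₂}

variable {V : Type u} [Fintype V] {τ : SimpleGraph V} {a : V}

theorem countOuter_anti {W : Type v} [Fintype W] (σ : SimpleGraph W) (b : W) (n : ℕ) :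
    Antitone (countOuter τ a σ b n) := by
  classical
  intro D E hDE
  cases n with
  | zero => exact le_rfl
  | succ n =>
    refine Finset.sum_le_sum fun x _ => ?_
    by_cases hx : x = a ∨ x ∈ E
    · simp [hx]
    · rw [if_neg hx, if_neg fun h => hx (h.imp_right (@hDE x))]
      exact count_anti _ antitone_const n (Set.image_mono
        (Set.insert_subset_insert (Set.inter_subset_inter_left _ hDE)))

/-- The word `x a` can be read from `∅` but not from `{a}`, as `a` survives reading its neighbour
`x`. At length 1 the two counts still agree, so 2 is the least length with a gap. -/
theorem countOuter_two_lt {W : Type v} [Fintype W] (σ : SimpleGraph W) (b : W) {x : V}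
    (hx : τ.Adj a x) : countOuter τ a σ b 2 {a} < countOuter τ a σ b 2 ∅ := by
  classical
  have hsub (y : V) : next τ ∅ y ⊆ next τ {a} y :=
    Set.insert_subset_insert (Set.inter_subset_inter_left _ (Set.empty_subset _))
  refine Finset.sum_lt_sum (fun y _ => ?_) ⟨x, Finset.mem_univ x, ?_⟩
  · by_cases hy : y = a
    · simp [hy]
    · simp only [hy, Set.mem_singleton_iff, Set.mem_empty_iff_false, or_self, if_false]
      exact count_anti _ antitone_const 1 (Set.image_mono (hsub y))
  · simp only [hx.ne', Set.mem_singleton_iff, Set.mem_empty_iff_false, or_self, if_false, count]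
    refine Finset.sum_lt_sum (fun s _ => ?_) ⟨.inl a, Finset.mem_univ _, ?_⟩
    · by_cases hs : s ∈ Sum.inl '' next τ {a} x
      · simp [hs]
      · rw [if_neg hs, if_neg fun h => hs (Set.image_mono (hsub x) h)]
    · have h1 : a ∈ next τ {a} x := Or.inr ⟨rfl, hx.symm⟩
      have h2 : a ∉ next τ ∅ x := by simp [next_empty, hx.ne]
      simp only [inl_mem_image_inl, h1, h2, if_true, if_false, zero_lt_one]

variable {W₁ W₂ : Type v} [Fintype W₁] [Fintype W₂] {σ₁ : SimpleGraph W₁} {b₁ : W₁}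
  {σ₂ : SimpleGraph W₂} {b₂ : W₂} {K : ℕ}

open Classical in
theorem countOuter_le_of_count_le {n : ℕ}
    (h : ∀ m < n, ∀ D : Set V,
      count (coalescence τ a σ₁ b₁) (fun _ => 1) m (Sum.inl '' D) ≤
        count (coalescence τ a σ₂ b₂) (fun _ => 1) m (Sum.inl '' D))
    {m : ℕ} (hm : m ≤ n) (D : Set V) : countOuter τ a σ₁ b₁ m D ≤ countOuter τ a σ₂ b₂ m D := by
  cases m with
  | zero => exact le_rfl
  | succ m =>
    refine Finset.sum_le_sum fun x _ => ?_
    split_ifs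
    · exact le_rfl
    · exact h m (by omega) _

theorem Dominated.splitTerm_empty_le (H : Dominated σ₁ b₁ σ₂ b₂ K) {k m : ℕ} (hk : k ≤ K)
    (h : ∀ D, countOuter τ a σ₁ b₁ m D ≤ countOuter τ a σ₂ b₂ m D) :
    splitTerm τ a σ₁ b₁ ∅ k m ≤ splitTerm τ a σ₂ b₂ ∅ k m :=
  mul_add_mul_le (H.free_empty k hk)
    (by simpa only [countFree_add_countHang] using H.all_empty k hk) (h _) (h _)
    (countOuter_anti σ₂ b₂ m (Set.empty_subset _))

theorem Dominated.splitTerm_root_le (H : Dominated σ₁ b₁ σ₂ b₂ K) {k m : ℕ} (hk : k ≤ K)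
    (h : ∀ D, countOuter τ a σ₁ b₁ m D ≤ countOuter τ a σ₂ b₂ m D) :
    splitTerm τ a σ₁ b₁ {b₁} k m ≤ splitTerm τ a σ₂ b₂ {b₂} k m :=
  mul_add_mul_le (H.free_root k hk)
    (by simpa only [countFree_add_countHang] using H.all_root k hk) (h _) (h _)
    (countOuter_anti σ₂ b₂ m (Set.empty_subset _))

open Classical in
theorem Dominated.count_le (H : Dominated σ₁ b₁ σ₂ b₂ K) (n : ℕ) (hn : n ≤ K) (D : Set V) :
    count (coalescence τ a σ₁ b₁) (fun _ => 1) n (Sum.inl '' D) ≤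
      count (coalescence τ a σ₂ b₂) (fun _ => 1) n (Sum.inl '' D) := by
  induction n using Nat.strong_induction_on generalizing D with
  | _ n ih =>
    -- The first letter of an outer word stays in τ, so `countOuter` at length `m` involves only
    -- coalescence counts at length `m - 1`; the induction hypothesis therefore covers `m = n` too.
    have hY {m : ℕ} (hm : m ≤ n) (D : Set V) :
        countOuter τ a σ₁ b₁ m D ≤ countOuter τ a σ₂ b₂ m D :=
      countOuter_le_of_count_le (fun m hm D => ih m hm (by omega) D) hm D
    by_cases ha : a ∈ D
    · rw [count_image_inl_of_mem ha, count_image_inl_of_mem ha]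
      refine Nat.add_le_add (hY le_rfl D) (Finset.sum_le_sum fun k hk => ?_)
      rw [Finset.mem_range] at hk
      exact H.splitTerm_root_le (by omega) (hY (by omega))
    · cases n with
      | zero => exact le_rfl
      | succ n =>
        rw [count_image_inl_of_not_mem ha, count_image_inl_of_not_mem ha]
        refine Nat.add_le_add (Nat.add_le_add (hY le_rfl D) (hY (by omega) _))
          (Nat.add_le_add (Finset.sum_le_sum fun k hk => ?_)
            (Nat.mul_le_mul (H.free_empty 1 (by omega)) (hY (by omega) _)))
        rw [Finset.mem_range] at hk
        exact H.splitTerm_empty_le (by omega) (hY (by omega))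

/-- If one of the inequalities of domination is strict at length `k + 2`, then the geodesic growth
of the coalescences differs at length `k + 4`. -/
theorem Dominated.growth_lt (H : Dominated σ₁ b₁ σ₂ b₂ K) {k : ℕ} (hk : k + 4 ≤ K)
    (hlt : countFree σ₁ b₁ (k + 2) ∅ < countFree σ₂ b₂ (k + 2) ∅) {x : V} (hx : τ.Adj a x) :
    growth (Geo (coalescence τ a σ₁ b₁)) (k + 4) <
      growth (Geo (coalescence τ a σ₂ b₂)) (k + 4) := by
  classical
  have hY {m : ℕ} (hm : m ≤ K) (D : Set V) :
      countOuter τ a σ₁ b₁ m D ≤ countOuter τ a σ₂ b₂ m D :=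
    countOuter_le_of_count_le (n := K) (fun m hm D => H.count_le m (by omega) D) hm D
  have ha : a ∉ (∅ : Set V) := Set.notMem_empty a
  have h₁ := count_image_inl_of_not_mem (τ := τ) (σ := σ₁) (b := b₁) ha (k + 3)
  have h₂ := count_image_inl_of_not_mem (τ := τ) (σ := σ₂) (b := b₂) ha (k + 3)
  rw [Set.image_empty] at h₁ h₂
  rw [growth_Geo, growth_Geo, h₁, h₂]
  refine Nat.add_lt_add_of_le_of_lt (Nat.add_le_add (hY (by omega) _) (hY (by omega) _))
    (Nat.add_lt_add_of_lt_of_le (Finset.sum_lt_sum (fun j hj => ?_)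
      ⟨k, Finset.mem_range.2 (by omega), ?_⟩)
      (Nat.mul_le_mul (H.free_empty 1 (by omega)) (hY (by omega) _)))
  · rw [Finset.mem_range] at hj
    exact H.splitTerm_empty_le (by omega) (hY (by omega))
  -- This summand pairs prefixes of length `k + 2` with continuations of length 2, where both
  -- factors of the comparison are strict.
  · rw [show k + 3 - (k + 1) = 2 by omega]
    exact mul_add_mul_lt hlt
      (by simpa only [countFree_add_countHang] using H.all_empty (k + 2) (by omega))
      (hY (by omega) _) (hY (by omega) _) (countOuter_two_lt σ₂ b₂ hx)

end Comparison

/-! ### Evaluation of the counts by dynamic programming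

All states of the automaton of a triangle-free graph that are reachable from `∅` are `∅`, the
singletons and the edges. The counts from singletons and edges are kept in a square table; `force`
makes the kernel evaluate each entry once. -/

section Evaluation

/-- `f v`, with `v` brought into normal form first. -/
def force {α : Type} (v : ℕ) (f : ℕ → α) : α :=
  match v with
  | 0 => f 0
  | m + 1 => f (m + 1)

theorem force_eq {α : Type} (v : ℕ) (f : ℕ → α) : force v f = f v := by
  cases v <;> rfl

/-- `k (l.map g)`, with the entries of the list brought into normal form first. -/
def forceMap {α : Type} (g : ℕ → ℕ) (l : List ℕ) (k : List ℕ → α) : α :=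
  match l with
  | [] => k []
  | x :: l => force (g x) fun v => forceMap g l fun vs => k (v :: vs)

theorem forceMap_eq {α : Type} (g : ℕ → ℕ) (l : List ℕ) (k : List ℕ → α) :
    forceMap g l k = k (l.map g) := by
  induction l generalizing k with
  | nil => rfl
  | cons x l ih => rw [forceMap, force_eq, ih, List.map_cons]

/-- `k` applied to the table of the values `g x y` for `x` in `l` and `y` in `m`. -/
def forceTable {α : Type} (g : ℕ → ℕ → ℕ) (m l : List ℕ) (k : List (List ℕ) → α) : α :=
  match l with
  | [] => k []
  | x :: l => forceMap (g x) m fun r => forceTable g m l fun rs => k (r :: rs)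

theorem forceTable_eq {α : Type} (g : ℕ → ℕ → ℕ) (m l : List ℕ) (k : List (List ℕ) → α) :
    forceTable g m l k = k (l.map fun x => m.map (g x)) := by
  induction l generalizing k with
  | nil => rfl
  | cons x l ih => rw [forceTable, forceMap_eq, ih, List.map_cons]

/-- The entry of a table. -/
def entry (L : List (List ℕ)) (x y : ℕ) : ℕ := (L.getD x []).getD y 0

theorem entry_map_range {n x y : ℕ} (f : ℕ → ℕ → ℕ) (hx : x < n) (hy : y < n) :
    entry ((List.range n).map fun x => (List.range n).map (f x)) x y = f x y := by
  simp [entry, hx, hy]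

/-- The adjacency relation on `{0, …, 15}` encoded in a number. -/
def adjBit (c x y : ℕ) : Bool := c.testBit (16 * x + y)

/-- The encoding of the graph with a given list of edges. -/
def edgeCode (l : List (ℕ × ℕ)) : ℕ :=
  (l.map fun e => 2 ^ (16 * e.1 + e.2) + 2 ^ (16 * e.2 + e.1)).sum

/-- The number of words read from the state `{x, y}`, in terms of the table for words that are
shorter by one. -/
def succEntry (n c : ℕ) (L : List (List ℕ)) (x y : ℕ) : ℕ :=
  bif x.beq y || adjBit c x y then
    ((List.range n).map fun s => bif s.beq x || s.beq y then 0 else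
      entry L s (bif adjBit c s x then x else bif adjBit c s y then y else s)).sum
  else 0

/-- The counts of the words of lengths `k + 1` from `∅` and `k` from `{0}`, for `K` successive
values of `k`, starting from the table of the counts for the first of them. -/
def evalCounts (n c : ℕ) : ℕ → List (List ℕ) → List (ℕ × ℕ)
  | 0, _ => []
  | K + 1, L => (((List.range n).map fun s => entry L s s).sum, entry L 0 0) ::
      forceTable (succEntry n c L) (List.range n) (List.range n) (evalCounts n c K)

/-- The counts for the graph on `{0, …, n - 1}` with edges `l`, with weights `φ`. -/
def runCounts (n : ℕ) (l : List (ℕ × ℕ)) (φ : ℕ → ℕ → ℕ) (K : ℕ) : List (ℕ × ℕ) :=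
  force (edgeCode l) fun c =>
    forceTable φ (List.range n) (List.range n) (evalCounts n c K)

theorem sum_map_range (n : ℕ) (f : ℕ → ℕ) : ((List.range n).map f).sum = ∑ i : Fin n, f i := by
  rw [← Finset.sum_range]
  rfl

/-- The table `L` holds the counts of words of length `k` from singletons and edges. -/
def Represents {n : ℕ} (σ : SimpleGraph (Fin n)) (φ : Set (Fin n) → ℕ) (k : ℕ)
    (L : List (List ℕ)) : Prop :=
  ∀ x y : Fin n, x = y ∨ σ.Adj x y → entry L x y = count σ φ k {x, y}

variable {n c : ℕ} {σ : SimpleGraph (Fin n)} {φ : Set (Fin n) → ℕ}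

/-- Without triangles, a letter outside an edge is adjacent to at most one of its ends, so the next
state is again a singleton or an edge. Entries at other pairs are never consulted. -/
theorem Represents.succ (hadj : ∀ i j : Fin n, adjBit c i j = true ↔ σ.Adj i j)
    (htri : ∀ i j k, σ.Adj i j → σ.Adj i k → ¬σ.Adj j k) {k : ℕ} {L : List (List ℕ)}
    (hL : Represents σ φ k L) :
    Represents σ φ (k + 1)
      ((List.range n).map fun x => (List.range n).map (succEntry n c L x)) := by
  intro x y hxy
  have hg : ((x : ℕ).beq y || adjBit c x y) = true := by
    rw [Bool.or_eq_true, hadj, Nat.beq_eq, Fin.val_inj]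
    exact hxy
  rw [entry_map_range _ x.2 y.2, succEntry, hg, cond_true, sum_map_range, count]
  refine Finset.sum_congr rfl fun s _ => ?_
  by_cases hs : s = x ∨ s = y
  · have h1 : ((s : ℕ).beq x || (s : ℕ).beq y) = true := by
      simpa [Bool.or_eq_true, Nat.beq_eq, Fin.val_inj] using hs
    rw [h1, cond_true, if_pos (by simpa using hs)]
  · have h1 : ((s : ℕ).beq x || (s : ℕ).beq y) = false := by
      rw [Bool.eq_false_iff, Ne, Bool.or_eq_true, Nat.beq_eq, Nat.beq_eq, Fin.val_inj, Fin.val_inj]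
      exact hs
    rw [h1, cond_false, if_neg (by simpa using hs)]
    have hnext (z : Fin n) (hz : z = s ∨ σ.Adj s z)
        (h : ∀ t, (t = x ∨ t = y) ∧ σ.Adj s t ∨ t = s ↔ t = z ∨ t = s) :
        entry L s z = count σ φ k (next σ {x, y} s) := by
      rw [hL s z (hz.imp_left Eq.symm)]
      congr 1
      ext t
      rw [mem_next, Set.mem_insert_iff, Set.mem_insert_iff, Set.mem_singleton_iff,
        Set.mem_singleton_iff, or_comm, or_comm (a := t = s), h]
    by_cases hsx : σ.Adj s x
    · rw [(hadj s x).2 hsx, cond_true]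
      refine hnext x (Or.inr hsx) fun t => ?_
      have hy : y = x ∨ ¬σ.Adj s y := hxy.imp Eq.symm fun h h' => htri s x y hsx h' h
      constructor
      · rintro (⟨rfl | rfl, h⟩ | rfl)
        · exact Or.inl rfl
        · exact Or.inl (hy.resolve_right (not_not.2 h))
        · exact Or.inr rfl
      · rintro (rfl | rfl)
        · exact Or.inl ⟨Or.inl rfl, hsx⟩
        · exact Or.inr rfl
    · rw [Bool.eq_false_iff.2 (mt (hadj s x).1 hsx), cond_false]
      by_cases hsy : σ.Adj s y
      · rw [(hadj s y).2 hsy, cond_true]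
        refine hnext y (Or.inr hsy) fun t => ?_
        constructor
        · rintro (⟨rfl | rfl, h⟩ | rfl)
          · exact absurd h hsx
          · exact Or.inl rfl
          · exact Or.inr rfl
        · rintro (rfl | rfl)
          · exact Or.inl ⟨Or.inr rfl, hsy⟩
          · exact Or.inr rfl
      · rw [Bool.eq_false_iff.2 (mt (hadj s y).1 hsy), cond_false]
        refine hnext s (Or.inl rfl) fun t => ?_
        constructor
        · rintro (⟨rfl | rfl, h⟩ | rfl)
          · exact absurd h hsx
          · exact absurd h hsy
          · exact Or.inr rfl
        · rintro (rfl | rfl) <;> exact Or.inr rfl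

theorem evalCounts_eq [NeZero n] (hadj : ∀ i j : Fin n, adjBit c i j = true ↔ σ.Adj i j)
    (htri : ∀ i j k, σ.Adj i j → σ.Adj i k → ¬σ.Adj j k) (K : ℕ) {k : ℕ} {L : List (List ℕ)}
    (hL : Represents σ φ k L) :
    evalCounts n c K L =
      (List.range' k K).map fun j => (count σ φ (j + 1) ∅, count σ φ j {0}) := by
  induction K generalizing k L with
  | zero => rfl
  | succ K ih =>
    rw [evalCounts, forceTable_eq, ih (hL.succ hadj htri), List.range'_succ, List.map_cons,
      sum_map_range, count]
    congr 2
    -- Reading `s` from `∅` leads to `{s}`, so the diagonal of the table for length `k` sums to the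
    -- count of length `k + 1` from `∅`.
    · refine Finset.sum_congr rfl fun s _ => ?_
      rw [hL s s (Or.inl rfl), if_neg (Set.notMem_empty s), next_empty, Set.pair_eq_singleton]
    · have := hL 0 0 (Or.inl rfl)
      rwa [Fin.val_zero, Set.pair_eq_singleton] at this

theorem runCounts_eq [NeZero n] {l : List (ℕ × ℕ)}
    (hadj : ∀ i j : Fin n, adjBit (edgeCode l) i j = true ↔ σ.Adj i j)
    (htri : ∀ i j k, σ.Adj i j → σ.Adj i k → ¬σ.Adj j k) {f : ℕ → ℕ → ℕ}
    (hf : ∀ x y : Fin n, f x y = φ {x, y}) (K : ℕ) :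
    runCounts n l f K =
      (List.range K).map fun j => (count σ φ (j + 1) ∅, count σ φ j {0}) := by
  have hR : Represents σ φ 0 ((List.range n).map fun x => (List.range n).map (f x)) := by
    intro x y _
    rw [entry_map_range _ x.2 y.2, count, hf]
  rw [runCounts, force_eq, forceTable_eq, evalCounts_eq hadj htri K hR, List.range_eq_range']

end Evaluation

/-! ### Checked encodings of graphs and comparison of tables -/

section Encoding

/-- The list `l` encodes the edges of the triangle-free graph `σ`. -/
structure Encodes {n : ℕ} (σ : SimpleGraph (Fin n)) (l : List (ℕ × ℕ)) : Prop where
  adj : ∀ i j : Fin n, adjBit (edgeCode l) i j = true ↔ σ.Adj i j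
  triangle_free : ∀ i j k, σ.Adj i j → σ.Adj i k → ¬σ.Adj j k

/-- Both hypotheses are finite checks on bits of the code, so for a concrete tree a decision
procedure confirms that the packing into one number is faithful, with no general argument about
collisions or carries. -/
theorem encodes_ofEdges {n : ℕ} {e : List (Fin n × Fin n)} {l : List (ℕ × ℕ)}
    (hadj : ∀ i j : Fin n, adjBit (edgeCode l) i j = true ↔ i ≠ j ∧ ((i, j) ∈ e ∨ (j, i) ∈ e))
    (htri : ∀ i j k : Fin n, adjBit (edgeCode l) i j → adjBit (edgeCode l) i k →
      ¬adjBit (edgeCode l) j k) : Encodes (ofEdges n e) l := by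
  have h (i j : Fin n) : adjBit (edgeCode l) i j = true ↔ (ofEdges n e).Adj i j := by
    rw [hadj, ofEdges, SimpleGraph.fromRel_adj]
  refine ⟨h, fun i j k => ?_⟩
  simp only [← h]
  exact htri i j k

/-- The numbers of words of lengths `k + 1` from `∅` and `k` from `{0}`, for `k < K`. -/
def allCounts (n : ℕ) (l : List (ℕ × ℕ)) (K : ℕ) : List (ℕ × ℕ) :=
  runCounts n l (fun _ _ => 1) K

/-- The numbers of words of lengths `k + 1` from `∅` and `k` from `{0}` that can be continued by
the letter `0`, for `k < K`. -/
def freeCounts (n : ℕ) (l : List (ℕ × ℕ)) (K : ℕ) : List (ℕ × ℕ) :=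
  runCounts n l (fun x y => bif x.beq 0 || y.beq 0 then 0 else 1) K

theorem Encodes.allCounts_eq {n : ℕ} [NeZero n] {σ : SimpleGraph (Fin n)} {l : List (ℕ × ℕ)}
    (h : Encodes σ l) (K : ℕ) : allCounts n l K = (List.range K).map fun j =>
      (count σ (fun _ => 1) (j + 1) ∅, count σ (fun _ => 1) j {0}) :=
  runCounts_eq h.adj h.triangle_free (fun _ _ => rfl) K

theorem Encodes.freeCounts_eq {n : ℕ} [NeZero n] {σ : SimpleGraph (Fin n)} {l : List (ℕ × ℕ)}
    (h : Encodes σ l) (K : ℕ) : freeCounts n l K = (List.range K).map fun j =>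
      (countFree σ 0 (j + 1) ∅, countFree σ 0 j {0}) := by
  refine runCounts_eq h.adj h.triangle_free (fun x y => ?_) K
  have hxy : (((x : ℕ).beq 0 || (y : ℕ).beq 0) = true) ↔ (0 : Fin n) ∈ ({x, y} : Set (Fin n)) := by
    rw [Bool.or_eq_true, Nat.beq_eq, Nat.beq_eq, Fin.val_eq_zero_iff, Fin.val_eq_zero_iff,
      Set.mem_insert_iff, Set.mem_singleton_iff, eq_comm, eq_comm (a := y)]
  rw [Bool.cond_eq_ite]
  split_ifs <;> tauto

theorem Dominated.of_counts {n m : ℕ} [NeZero n] [NeZero m] {σ₁ : SimpleGraph (Fin n)}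
    {σ₂ : SimpleGraph (Fin m)} {l₁ l₂ : List (ℕ × ℕ)} (h₁ : Encodes σ₁ l₁) (h₂ : Encodes σ₂ l₂)
    {K : ℕ}
    (hall : List.Forall₂ (fun p q => p.1 ≤ q.1 ∧ p.2 ≤ q.2)
      (allCounts n l₁ (K + 1)) (allCounts m l₂ (K + 1)))
    (hfree : List.Forall₂ (fun p q => p.1 ≤ q.1 ∧ p.2 ≤ q.2)
      (freeCounts n l₁ (K + 1)) (freeCounts m l₂ (K + 1))) :
    Dominated σ₁ 0 σ₂ 0 K := by
  rw [h₁.allCounts_eq, h₂.allCounts_eq, List.forall₂_map_left_iff, List.forall₂_map_right_iff,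
    List.forall₂_same] at hall
  rw [h₁.freeCounts_eq, h₂.freeCounts_eq, List.forall₂_map_left_iff, List.forall₂_map_right_iff,
    List.forall₂_same] at hfree
  simp only [List.mem_range] at hall hfree
  refine ⟨fun k hk => ?_, fun k hk => ?_, fun k hk => (hfree k (by omega)).2,
    fun k hk => (hall k (by omega)).2⟩
  -- The tables start at length 1 for the state `∅`, so length 0 is treated separately.
  · cases k with
    | zero => simp [countFree, count]
    | succ k => exact (hfree k (by omega)).1
  · cases k with
    | zero => simp [count]
    | succ k => exact (hall k (by omega)).1

end Encoding

/-! ### The trees `S₁`, `S₂` and their subdivisions -/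

section Trees

theorem encodes_S₁ : Encodes S₁
    [(0, 1), (0, 2), (1, 3), (2, 4), (2, 5), (3, 6), (5, 7), (7, 8), (7, 9)] :=
  encodes_ofEdges (by decide +kernel) (by decide +kernel)

theorem allCounts_S₁ : allCounts 10
    [(0, 1), (0, 2), (1, 3), (2, 4), (2, 5), (3, 6), (5, 7), (7, 8), (7, 9)] 11 =
    [(10, 1), (90, 9), (792, 79), (6964, 695), (61228, 6112), (538316, 53737), (4732856, 472456),
     (41611096, 4153819), (365843200, 36520225), (3216479704, 321084456),
     (28279168956, 2822962509)] := by
  decide +kernel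

theorem freeCounts_S₁ : freeCounts 10
    [(0, 1), (0, 2), (1, 3), (2, 4), (2, 5), (3, 6), (5, 7), (7, 8), (7, 9)] 11 =
    [(9, 0), (79, 7), (695, 70), (6112, 609), (53737, 5364), (472456, 47162), (4153819, 414654),
     (36520225, 3645621), (321084456, 32052194), (2822962509, 281801674),
     (24819380539, 2477589810)] := by
  decide +kernel

theorem encodes_S₂ : Encodes S₂
    [(0, 1), (0, 2), (1, 3), (1, 4), (2, 5), (2, 6), (3, 7), (7, 8), (8, 9)] :=
  encodes_ofEdges (by decide +kernel) (by decide +kernel)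

theorem allCounts_S₂ : allCounts 10
    [(0, 1), (0, 2), (1, 3), (1, 4), (2, 5), (2, 6), (3, 7), (7, 8), (8, 9)] 11 =
    [(10, 1), (90, 9), (792, 79), (6964, 695), (61228, 6113), (538316, 53747), (4732856, 472546),
     (41611096, 4154611), (365843200, 36527194), (3216479704, 321145730),
     (28279168956, 2823501235)] := by
  decide +kernel

theorem freeCounts_S₂ : freeCounts 10
    [(0, 1), (0, 2), (1, 3), (1, 4), (2, 5), (2, 6), (3, 7), (7, 8), (8, 9)] 11 =
    [(9, 0), (79, 7), (695, 70), (6113, 609), (53747, 5366), (472546, 47179), (4154611, 414812),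
     (36527194, 3647011), (321145730, 32064426), (2823501235, 281909240),
     (24824117010, 2478535526)] := by
  decide +kernel

theorem encodes_S₁ext : Encodes S₁ext
    [(0, 1), (0, 2), (1, 3), (2, 4), (2, 5), (3, 6), (5, 10), (10, 7), (7, 8), (7, 9)] :=
  encodes_ofEdges (by decide +kernel) (by decide +kernel)

theorem allCounts_S₁ext : allCounts 11
    [(0, 1), (0, 2), (1, 3), (2, 4), (2, 5), (3, 6), (5, 10), (10, 7), (7, 8), (7, 9)] 11 =
    [(11, 1), (110, 10), (1080, 98), (10598, 962), (103992, 9441), (1020408, 92639),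
     (10012608, 909009), (98247278, 8919523), (964037282, 87521539), (9459477130, 858792515),
     (92819758316, 8426777997)] := by
  decide +kernel

theorem freeCounts_S₁ext : freeCounts 11
    [(0, 1), (0, 2), (1, 3), (2, 4), (2, 5), (3, 6), (5, 10), (10, 7), (7, 8), (7, 9)] 11 =
    [(10, 0), (98, 8), (962, 88), (9441, 856), (92639, 8410), (909009, 82525), (8919523, 809772),
     (87521539, 7945768), (858792515, 77966740), (8426777997, 765037404),
     (82686546667, 7506819506)] := by
  decide +kernel

theorem encodes_S₂ext : Encodes S₂ext
    [(0, 10), (10, 1), (0, 2), (1, 3), (1, 4), (2, 5), (2, 6), (3, 7), (7, 8), (8, 9)] :=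
  encodes_ofEdges (by decide +kernel) (by decide +kernel)

theorem allCounts_S₂ext : allCounts 11
    [(0, 10), (10, 1), (0, 2), (1, 3), (1, 4), (2, 5), (2, 6), (3, 7), (7, 8), (8, 9)] 11 =
    [(11, 1), (110, 10), (1080, 98), (10598, 962), (103992, 9441), (1020408, 92639),
     (10012608, 909009), (98247278, 8919522), (964037282, 87521530), (9459477130, 858792424),
     (92819758316, 8426777105)] := by
  decide +kernel

theorem freeCounts_S₂ext : freeCounts 11
    [(0, 10), (10, 1), (0, 2), (1, 3), (1, 4), (2, 5), (2, 6), (3, 7), (7, 8), (8, 9)] 11 =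
    [(10, 0), (98, 8), (962, 88), (9441, 856), (92639, 8410), (909009, 82525), (8919522, 809772),
     (87521530, 7945766), (858792424, 77966724), (8426777105, 765037242),
     (82686537908, 7506817916)] := by
  decide +kernel

theorem dominated_S₁_S₂ : Dominated S₁ 0 S₂ 0 10 :=
  .of_counts encodes_S₁ encodes_S₂
    (by rw [allCounts_S₁, allCounts_S₂]; simp)
    (by rw [freeCounts_S₁, freeCounts_S₂]; simp)

/-- Subdivision reverses the order: here the tree derived from `S₁` has the larger counts. -/
theorem dominated_S₂ext_S₁ext : Dominated S₂ext 0 S₁ext 0 10 :=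
  .of_counts encodes_S₂ext encodes_S₁ext
    (by rw [allCounts_S₁ext, allCounts_S₂ext]; simp)
    (by rw [freeCounts_S₁ext, freeCounts_S₂ext]; simp)

/-- The tables already differ at length 4, but length 8 is the one that yields growth at length 10.
Entry 7 of the table belongs to length 8. -/
theorem countFree_S₁_lt : countFree S₁ 0 8 ∅ < countFree S₂ 0 8 ∅ := by
  have h₁ := (encodes_S₁.freeCounts_eq 11).symm.trans freeCounts_S₁
  have h₂ := (encodes_S₂.freeCounts_eq 11).symm.trans freeCounts_S₂
  have h₁ := congrArg (fun L => (L.getD 7 (0, 0)).1) h₁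
  have h₂ := congrArg (fun L => (L.getD 7 (0, 0)).1) h₂
  simp at h₁ h₂
  rw [h₁, h₂]
  norm_num

theorem countFree_S₂ext_lt : countFree S₂ext 0 8 ∅ < countFree S₁ext 0 8 ∅ := by
  have h₁ := (encodes_S₁ext.freeCounts_eq 11).symm.trans freeCounts_S₁ext
  have h₂ := (encodes_S₂ext.freeCounts_eq 11).symm.trans freeCounts_S₂ext
  have h₁ := congrArg (fun L => (L.getD 7 (0, 0)).1) h₁
  have h₂ := congrArg (fun L => (L.getD 7 (0, 0)).1) h₂
  simp at h₁ h₂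
  rw [h₁, h₂]
  norm_num

theorem growth_GeoStart_S₁ext {r : ℕ} (hr : r < 11) :
    growth (GeoStart S₁ext 0) (r + 1) = ((allCounts 11
      [(0, 1), (0, 2), (1, 3), (2, 4), (2, 5), (3, 6), (5, 10), (10, 7), (7, 8), (7, 9)]
      11).getD r (0, 0)).2 := by
  rw [encodes_S₁ext.allCounts_eq, growth_GeoStart_succ]
  simp [hr]

theorem growth_GeoStart_S₂ext {r : ℕ} (hr : r < 11) :
    growth (GeoStart S₂ext 0) (r + 1) = ((allCounts 11
      [(0, 10), (10, 1), (0, 2), (1, 3), (1, 4), (2, 5), (2, 6), (3, 7), (7, 8), (8, 9)]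
      11).getD r (0, 0)).2 := by
  rw [encodes_S₂ext.allCounts_eq, growth_GeoStart_succ]
  simp [hr]

theorem geodesicGrowthSeries_ne {V W : Type*} {Γ : SimpleGraph V} {Δ : SimpleGraph W} {r : ℕ}
    (h : growth (Geo Γ) r ≠ growth (Geo Δ) r) :
    geodesicGrowthSeries Γ ≠ geodesicGrowthSeries Δ := by
  intro heq
  have := congrArg (PowerSeries.coeff r) heq
  simp only [geodesicGrowthSeries, PowerSeries.coeff_mk] at this
  exact h this

theorem exists_adj_root {V : Type*} [Finite V] {τ : SimpleGraph V} (hτ : τ.IsTree)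
    (hV : 2 ≤ Nat.card V) (a : V) : ∃ x, τ.Adj a x := by
  have : Nontrivial V := Finite.one_lt_card_iff_nontrivial.1 hV
  exact hτ.connected.preconnected.exists_adj_of_nontrivial a

end Trees

end RACG

end


theorem lemma5p2 :
    -- the ten-vertex trees `S₁`, `S₂`
    (∀ (V : Type*) [Finite V] (τ : SimpleGraph V) (root : V), τ.IsTree → 2 ≤ Nat.card V →
      RACG.geodesicGrowthSeries (RACG.coalescence τ root RACG.S₁ 0) ≠
        RACG.geodesicGrowthSeries (RACG.coalescence τ root RACG.S₂ 0) ∧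
      RACG.growth (RACG.Geo (RACG.coalescence τ root RACG.S₁ 0)) 10 ≠
        RACG.growth (RACG.Geo (RACG.coalescence τ root RACG.S₂ 0)) 10) ∧
    -- the eleven-vertex trees, to which the counts below belong
    (∀ (V : Type*) [Finite V] (τ : SimpleGraph V) (root : V), τ.IsTree → 2 ≤ Nat.card V →
      RACG.geodesicGrowthSeries (RACG.coalescence τ root RACG.S₁ext 0) ≠
        RACG.geodesicGrowthSeries (RACG.coalescence τ root RACG.S₂ext 0) ∧
      RACG.growth (RACG.Geo (RACG.coalescence τ root RACG.S₁ext 0)) 10 ≠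
        RACG.growth (RACG.Geo (RACG.coalescence τ root RACG.S₂ext 0)) 10) ∧
    (∀ r < 8, RACG.growth (RACG.GeoStart RACG.S₁ext 0) r =
      RACG.growth (RACG.GeoStart RACG.S₂ext 0) r) ∧
    RACG.growth (RACG.GeoStart RACG.S₁ext 0) 8 = 8919523 ∧
    RACG.growth (RACG.GeoEnd RACG.S₁ext 0) 8 = 8919523 ∧
    RACG.growth (RACG.GeoStart RACG.S₂ext 0) 8 = 8919522 ∧
    RACG.growth (RACG.GeoEnd RACG.S₂ext 0) 8 = 8919522 := by
  refine ⟨fun V _ τ root hτ hV => ?_, fun V _ τ root hτ hV => ?_, fun r hr => ?_, ?_, ?_, ?_, ?_⟩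
  · have := Fintype.ofFinite V
    obtain ⟨x, hx⟩ := RACG.exists_adj_root hτ hV root
    -- With `k = 6` the strict prefix length is 8 and the growth length is 10, exactly the range of
    -- the domination.
    have h := (RACG.dominated_S₁_S₂.growth_lt (k := 6) le_rfl RACG.countFree_S₁_lt hx).ne
    exact ⟨RACG.geodesicGrowthSeries_ne h, h⟩
  · have := Fintype.ofFinite V
    obtain ⟨x, hx⟩ := RACG.exists_adj_root hτ hV root
    have h := (RACG.dominated_S₂ext_S₁ext.growth_lt (k := 6) le_rfl RACG.countFree_S₂ext_lt hx).ne'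
    exact ⟨RACG.geodesicGrowthSeries_ne h, h⟩
  · cases r with
    | zero => rw [RACG.growth_GeoStart_zero, RACG.growth_GeoStart_zero]
    | succ r =>
      rw [RACG.growth_GeoStart_S₁ext (by omega), RACG.growth_GeoStart_S₂ext (by omega),
        RACG.allCounts_S₁ext, RACG.allCounts_S₂ext]
      have hr' : r < 7 := by omega
      interval_cases r <;> rfl
  · rw [RACG.growth_GeoStart_S₁ext (by omega), RACG.allCounts_S₁ext]
    rfl
  · rw [RACG.growth_GeoEnd, RACG.growth_GeoStart_S₁ext (by omega), RACG.allCounts_S₁ext]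
    rfl
  · rw [RACG.growth_GeoStart_S₂ext (by omega), RACG.allCounts_S₂ext]
    rfl
  · rw [RACG.growth_GeoEnd, RACG.growth_GeoStart_S₂ext (by omega), RACG.allCounts_S₂ext]
    rfl
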